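/- Let $F$ be an algebraically closed field of characteristic $0$, let $n$ be a natural number, let $\mathcal A = M_n(F)$ be the algebra of $n\times n$ matrices over $F$, and let $f$ be an element of the free algebra $F\langle X_1, X_2, \dots\rangle$, say $f = f(X_1,\dots,X_m)$. Write $f(\mathcal A) = \{f(a_1,\dots,a_m) \mid a_1,\dots,a_m\in\mathcal A\}$. Suppose that $f$ is neither an identity of $\mathcal A$ (that is, $f(\mathcal A)\neq\{0\}$) nor a central polynomial for $\mathcal A$ (a polynomial that is not an identity of $\mathcal A$ and whose image $f(\mathcal A)$ is contained in the center of $\mathcal A$). Suppose further that either (a) $n$ is prime, or (b) $f$ is multilinear, i.e. for some $k$ and some distinct variables $Y_1,\dots,Y_k$ among the $X_i$, $f$ is a linear combination over $F$ of the monomials $Y_{\sigma(1)}Y_{\sigma(2)}\cdots Y_{\sigma(k)}$ with $\sigma\in S_k$. Then the set $f(\mathcal A)-f(\mathcal A) = \{s-t \mid s,t\in f(\mathcal A)\}$ contains every matrix in $\mathcal A$ of trace zero. -/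

import Mathlib

open scoped Pointwise

namespace NCPoly

/-- The image `f(A)` of a noncommutative polynomial `f` in the variables `X 0, X 1, …` over `F`,
evaluated in an `F`-algebra `A`: the set of all values `f(a 0, a 1, …)`. (As `f` involves only
finitely many variables, each value depends on finitely many of the `a i`.) -/
def image {F : Type*} [Field F] (f : FreeAlgebra F ℕ) (A : Type*) [Ring A] [Algebra F A] : Set A :=
  Set.range fun a : ℕ → A => FreeAlgebra.lift F a f

/-- `f` is a polynomial identity of `A`: its image is `{0}`. -/
def IsIdentity {F : Type*} [Field F] (f : FreeAlgebra F ℕ) (A : Type*) [Ring A] [Algebra F A] :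
    Prop :=
  image f A = {0}

/-- `f` is a central polynomial for `A`: its image is contained in the center of `A`, but `f` is
not an identity of `A`. -/
def IsCentral {F : Type*} [Field F] (f : FreeAlgebra F ℕ) (A : Type*) [Ring A] [Algebra F A] :
    Prop :=
  image f A ⊆ Set.center A ∧ ¬ IsIdentity f A

/-- `f` is multilinear: for some distinct variables `x 0, …, x (m - 1)`, it is a linear combination
of the monomials `x (σ 0) ⋯ x (σ (m - 1))`, where `σ` runs over the permutations of the indices. -/
def IsMultilinear {F : Type*} [Field F] (f : FreeAlgebra F ℕ) : Prop :=
  ∃ (m : ℕ) (x : Fin m → ℕ) (c : Equiv.Perm (Fin m) → F), Function.Injective x ∧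
    f = ∑ σ : Equiv.Perm (Fin m), c σ • (List.ofFn fun i => FreeAlgebra.ι F (x (σ i))).prod

end NCPoly

namespace NCPoly

open Matrix Polynomial

/-! ### Conjugation invariance of the image -/

section Conjugation

variable {F : Type*} [Field F] {A : Type*} [Ring A] [Algebra F A]

/-! The image is closed under conjugation, so it suffices that it contain one matrix with distinct
eigenvalues `d`: it then contains every matrix with those eigenvalues. A trace-zero matrix is
similar to some `S` with zero diagonal, and `S` is the difference of an upper and a lower triangular
matrix, both with diagonal `d` (`mem_image_sub_image_of_hasDistinctEigenvalues`).

Such a value is built from a noncentral one using the clock and shift matrices `P`, `Q`, with `Q P =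
ζ P Q`: an invertible `W` satisfying `V W = ω W V`, with `V` invertible and `ω` of order `n`, has
distinct eigenvalues.

For multilinear `f`, grade matrices by `j - i` mod `n`. Some homogeneous substitution gives a value
of degree 1, and averaging over cyclic shifts makes it invertible; it commutes with `P` up to a
primitive root of unity.

For `n` prime, every noncentral `P ^ i * Q ^ j` has distinct eigenvalues. Scaling each such product
in the arguments by `s ^ i * t ^ j` deforms the given value inside the image. Along a suitable curve
a single noncentral term dominates, and nonvanishing of the discriminant is an open condition. -/

theorem lift_semiconj (f : FreeAlgebra F ℕ) {u : A} {a b : ℕ → A}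
    (h : ∀ k, u * a k = b k * u) :
    u * FreeAlgebra.lift F a f = FreeAlgebra.lift F b f * u := by
  induction f using FreeAlgebra.induction with
  | grade0 r => simp [Algebra.commutes]
  | grade1 k => simpa using h k
  | mul x y hx hy => rw [map_mul, map_mul, ← mul_assoc, hx, mul_assoc, hy, mul_assoc]
  | add x y hx hy => rw [map_add, map_add, mul_add, hx, hy, add_mul]

theorem algHom_lift {B : Type*} [Ring B] [Algebra F B] (φ : A →ₐ[F] B) (a : ℕ → A)
    (f : FreeAlgebra F ℕ) :
    φ (FreeAlgebra.lift F a f) = FreeAlgebra.lift F (fun k => φ (a k)) f := by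
  have h : φ.comp (FreeAlgebra.lift F a) = FreeAlgebra.lift F (fun k => φ (a k)) := by
    ext k; simp
  exact DFunLike.congr_fun h f

theorem conj_mem_image {f : FreeAlgebra F ℕ} {u v s : A} (hvu : v * u = 1)
    (huv : u * v = 1) (hs : s ∈ image f A) : u * s * v ∈ image f A := by
  obtain ⟨a, rfl⟩ := hs
  refine ⟨fun k => u * a k * v, ?_⟩
  have h := lift_semiconj f (u := u) (a := a) (b := fun k => u * a k * v)
    (fun k => by rw [mul_assoc, hvu, mul_one])
  change _ = u * FreeAlgebra.lift F a f * v
  rw [h, mul_assoc, huv, mul_one]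

end Conjugation

/-! ### Trace-zero matrices and zero diagonals -/

section ZeroDiagonal

variable {F : Type*} [Field F] {ι : Type*} [Fintype ι] [DecidableEq ι]

/-- Similarity of square matrices, by an explicit pair of mutually inverse matrices. -/
def Similar (S T : Matrix ι ι F) : Prop :=
  ∃ u v : Matrix ι ι F, u * v = 1 ∧ v * u = 1 ∧ T = u * S * v

theorem Similar.refl (S : Matrix ι ι F) : Similar S S := ⟨1, 1, by simp, by simp, by simp⟩

theorem Similar.trans {S T U : Matrix ι ι F} (h : Similar S T) (h' : Similar T U) :
    Similar S U := by
  obtain ⟨u, v, huv, hvu, rfl⟩ := h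
  obtain ⟨u', v', huv', hvu', rfl⟩ := h'
  refine ⟨u' * u, v * v', ?_, ?_, by simp only [mul_assoc]⟩
  · rw [mul_assoc, ← mul_assoc u, huv, one_mul, huv']
  · rw [mul_assoc, ← mul_assoc v', hvu', one_mul, hvu]

theorem Similar.symm {S T : Matrix ι ι F} (h : Similar S T) : Similar T S := by
  obtain ⟨u, v, huv, hvu, rfl⟩ := h
  refine ⟨v, u, hvu, huv, ?_⟩
  rw [mul_assoc u, ← mul_assoc v, hvu, one_mul, mul_assoc, hvu, mul_one]

theorem Similar.trace_eq {S T : Matrix ι ι F} (h : Similar S T) : T.trace = S.trace := by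
  obtain ⟨u, v, huv, hvu, rfl⟩ := h
  rw [Matrix.trace_mul_comm, ← mul_assoc, hvu, one_mul]

theorem Similar.charpoly_eq {S T : Matrix ι ι F} (h : Similar S T) :
    T.charpoly = S.charpoly := by
  obtain ⟨u, v, huv, hvu, rfl⟩ := h
  have : u⁻¹ = v := inv_eq_right_inv huv
  simpa [this] using charpoly_units_conj ⟨u, v, huv, hvu⟩ S

theorem Similar.mem_image {f : FreeAlgebra F ℕ} {S T : Matrix ι ι F} (h : Similar S T)
    (hS : S ∈ image f (Matrix ι ι F)) : T ∈ image f (Matrix ι ι F) := by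
  obtain ⟨u, v, huv, hvu, rfl⟩ := h
  exact conj_mem_image hvu huv hS

theorem similar_transvection (T : Matrix ι ι F) {i j : ι} (hij : i ≠ j) (c : F) :
    Similar T (transvection i j c * T * transvection i j (-c)) :=
  ⟨_, _, by simp [transvection_mul_transvection_same _ _ hij],
    by simp [transvection_mul_transvection_same _ _ hij], rfl⟩

theorem exists_similar_diag_of_apply_ne_zero (T : Matrix ι ι F) {i j : ι} (hij : i ≠ j)
    (h : T j i ≠ 0) :
    ∃ S, Similar T S ∧ S i i = 0 ∧ ∀ k, k ≠ i → k ≠ j → S k k = T k k := by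
  -- This conjugation adds `c * T j i` to the entry `(i, i)`; `c` is chosen to cancel it.
  refine ⟨_, similar_transvection T hij (-T i i / T j i), ?_, fun k hi hj => ?_⟩
  · simp [hij, h]
  · simp [hi, hj]

theorem exists_similar_diag_of_ne (T : Matrix ι ι F) {i j : ι} (h : T i i ≠ T j j) :
    ∃ S, Similar T S ∧ (S i i = 0 ∨ S j j = 0) ∧ ∀ k, k ≠ i → k ≠ j → S k k = T k k := by
  have hij : i ≠ j := by rintro rfl; exact h rfl
  by_cases h1 : T j i = 0
  · obtain ⟨R, hR, hRij, hRd⟩ : ∃ R, Similar T R ∧ R i j ≠ 0 ∧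
        ∀ k, k ≠ i → k ≠ j → R k k = T k k := by
      by_cases h2 : T i j = 0
      -- The new entry `(i, j)` is `T j j - T i i`.
      · refine ⟨_, similar_transvection T hij 1, ?_, fun k hi hj => ?_⟩
        · simpa [h1, h2, add_neg_eq_zero] using h.symm
        · simp [hi, hj]
      · exact ⟨T, .refl T, h2, fun _ _ _ => rfl⟩
    obtain ⟨S, hS, h0, hSd⟩ := exists_similar_diag_of_apply_ne_zero R hij.symm hRij
    exact ⟨S, hR.trans hS, .inr h0, fun k hi hj => (hSd k hj hi).trans (hRd k hi hj)⟩
  · obtain ⟨S, hS, h0, hSd⟩ := exists_similar_diag_of_apply_ne_zero T hij h1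
    exact ⟨S, hS, .inl h0, hSd⟩

/-- Over a field of characteristic zero, a matrix of trace zero is similar to one with zero
diagonal. -/
theorem exists_similar_diag_eq_zero [CharZero F] (T : Matrix ι ι F) (hT : T.trace = 0) :
    ∃ S, Similar T S ∧ ∀ i, S i i = 0 := by
  classical
  induction hm : (Finset.univ.filter fun i => T i i ≠ 0).card using Nat.strong_induction_on
    generalizing T with
  | _ m ih =>
    by_cases h0 : ∀ i, T i i = 0
    · exact ⟨T, .refl T, h0⟩
    push Not at h0
    obtain ⟨i, hi⟩ := h0
    -- Were all nonzero diagonal entries equal, the trace would be a positive multiple of `T i i`,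
    -- nonzero in characteristic zero.
    obtain ⟨j, hj0, hj⟩ : ∃ j, T j j ≠ 0 ∧ T i i ≠ T j j := by
      by_contra! hall
      have hsum : ∑ j, T j j = (Finset.univ.filter fun j => T j j ≠ 0).card • T i i := by
        rw [← Finset.sum_filter_ne_zero, ← Finset.sum_const]
        refine Finset.sum_congr rfl fun j hj => ?_
        exact (hall j (by simpa using hj)).symm
      have : ∑ j, T j j = 0 := hT
      rw [this, eq_comm, smul_eq_zero, Finset.card_eq_zero] at hsum
      rcases hsum with hs | hs
      · have : i ∈ Finset.univ.filter fun j => T j j ≠ 0 := by simpa using hi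
        simp [hs] at this
      · exact hi hs
    obtain ⟨S, hS, hz, hd⟩ := exists_similar_diag_of_ne T hj
    suffices hlt : (Finset.univ.filter fun i => S i i ≠ 0).card < m by
      obtain ⟨R, hR, hR0⟩ := ih _ hlt S (hS.trace_eq.trans hT) rfl
      exact ⟨R, hS.trans hR, hR0⟩
    subst hm
    apply Finset.card_lt_card
    rw [Finset.ssubset_iff_of_subset]
    · rcases hz with hz | hz
      · exact ⟨i, by simpa using hi, by simpa using hz⟩
      · exact ⟨j, by simpa using hj0, by simpa using hz⟩
    · intro k hk
      simp only [Finset.mem_filter, Finset.mem_univ, true_and] at hk ⊢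
      by_cases hki : k = i
      · exact hki ▸ hi
      by_cases hkj : k = j
      · exact hkj ▸ hj0
      rwa [← hd k hki hkj]

end ZeroDiagonal

/-! ### Distinct eigenvalues and the discriminant -/

section DistinctEigenvalues

variable {F : Type*} [Field F] {ι : Type*} [Fintype ι] [DecidableEq ι]

/-- An `ι × ι` matrix with pairwise distinct eigenvalues indexed by `ι`. -/
def HasDistinctEigenvalues (M : Matrix ι ι F) : Prop :=
  ∃ (d : ι → F) (v : ι → ι → F), Function.Injective d ∧
    ∀ i, v i ≠ 0 ∧ M *ᵥ v i = d i • v i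

theorem HasDistinctEigenvalues.similar_diagonal {M : Matrix ι ι F} {d : ι → F}
    {v : ι → ι → F} (hd : Function.Injective d) (hv : ∀ i, v i ≠ 0 ∧ M *ᵥ v i = d i • v i) :
    Similar (diagonal d) M := by
  have hli : LinearIndependent F v :=
    Module.End.eigenvectors_linearIndependent' M.toLin' d hd v fun i =>
      ⟨Module.End.mem_eigenspace_iff.2 (by simpa using (hv i).2), (hv i).1⟩
  let V : Matrix ι ι F := (Matrix.of v)ᵀ
  have hV : IsUnit V := linearIndependent_cols_iff_isUnit.1 hli
  obtain ⟨u, hu⟩ := hV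
  have hMV : M * V = V * diagonal d := by
    ext k i
    have := congrFun (hv i).2 k
    rw [mul_diagonal]
    simpa [V, Matrix.mul_apply, mulVec, dotProduct, mul_comm] using this
  refine ⟨V, ↑u⁻¹, by simp [← hu], by simp [← hu], ?_⟩
  rw [← hMV, mul_assoc, ← hu, Units.mul_inv, mul_one]

theorem exists_eigenvector_of_isRoot_charpoly {M : Matrix ι ι F} {c : F}
    (h : M.charpoly.IsRoot c) : ∃ v, v ≠ 0 ∧ M *ᵥ v = c • v := by
  rw [IsRoot, eval_charpoly, ← exists_mulVec_eq_zero_iff] at h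
  obtain ⟨v, hv, h⟩ := h
  refine ⟨v, hv, ?_⟩
  rw [sub_mulVec, sub_eq_zero] at h
  rw [← h]
  ext i
  simp [Matrix.scalar_apply, mulVec_diagonal]

theorem similar_diagonal_of_charpoly_eq {M : Matrix ι ι F} {d : ι → F}
    (hd : Function.Injective d) (h : M.charpoly = ∏ i, (X - C (d i))) :
    Similar (diagonal d) M := by
  have hv : ∀ i, ∃ v, v ≠ 0 ∧ M *ᵥ v = d i • v := fun i =>
    exists_eigenvector_of_isRoot_charpoly (by
      rw [h, IsRoot, eval_prod]
      exact Finset.prod_eq_zero (Finset.mem_univ i) (by simp))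
  choose v hv using hv
  exact HasDistinctEigenvalues.similar_diagonal hd hv

theorem HasDistinctEigenvalues.separable {M : Matrix ι ι F} (h : HasDistinctEigenvalues M) :
    M.charpoly.Separable := by
  obtain ⟨d, v, hd, hv⟩ := h
  rw [(similar_diagonal hd hv).charpoly_eq, charpoly_diagonal]
  exact separable_prod_X_sub_C_iff.2 hd

theorem hasDistinctEigenvalues_of_separable [IsAlgClosed F] {M : Matrix ι ι F}
    (h : M.charpoly.Separable) : HasDistinctEigenvalues M := by
  classical
  have hcard : M.charpoly.roots.toFinset.card = Fintype.card ι := by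
    rw [Multiset.toFinset_card_of_nodup (nodup_roots h), ← charpoly_natDegree_eq_dim M]
    exact (splits_iff_card_roots.1 (IsAlgClosed.splits _))
  have e : ι ≃ M.charpoly.roots.toFinset := Fintype.equivOfCardEq (by simp [hcard])
  have hv : ∀ i, ∃ v, v ≠ 0 ∧ M *ᵥ v = (e i : F) • v := fun i =>
    exists_eigenvector_of_isRoot_charpoly
      (isRoot_of_mem_roots (Multiset.mem_toFinset.1 (e i).2))
  choose v hv using hv
  exact ⟨fun i => e i, v, Subtype.val_injective.comp e.injective, hv⟩

/-- Up to sign, the discriminant of the characteristic polynomial. -/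
noncomputable def charDisc {R : Type*} [CommRing R] (M : Matrix ι ι R) : R :=
  (aeval M (derivative M.charpoly)).det

theorem charDisc_map {R S : Type*} [CommRing R] [CommRing S] (φ : R →+* S)
    (M : Matrix ι ι R) : charDisc (M.map φ) = φ (charDisc M) := by
  rw [charDisc, charDisc, charpoly_map, derivative_map, RingHom.map_det]
  congr 1
  refine (map_aeval_eq_aeval_map (φ := φ) (ψ := (φ.mapMatrix : Matrix ι ι R →+* Matrix ι ι S))
    ?_ _ _).symm
  ext a i j
  simp [Matrix.algebraMap_matrix_apply, apply_ite φ]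

/-- A common root of the characteristic polynomial `p` and `p'` is an eigenvalue whose eigenvector
is killed by `p'(M)`. Conversely, a Bézout relation for `p`, `p'` evaluated at `M` inverts `p'(M)`,
by Cayley–Hamilton. -/
theorem charDisc_ne_zero_iff [IsAlgClosed F] {M : Matrix ι ι F} :
    charDisc M ≠ 0 ↔ HasDistinctEigenvalues M := by
  constructor
  · intro h
    apply hasDistinctEigenvalues_of_separable
    rw [Separable, isCoprime_iff_aeval_ne_zero_of_isAlgClosed F F]
    by_contra! hc
    obtain ⟨c, hc, hc'⟩ := hc
    change eval c _ = 0 at hc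
    change eval c _ = 0 at hc'
    obtain ⟨v, hv, hMv⟩ := exists_eigenvector_of_isRoot_charpoly (M := M) (c := c) hc
    refine h (exists_mulVec_eq_zero_iff.1 ⟨v, hv, ?_⟩)
    have hev : Module.End.HasEigenvector (toLin' M) c v :=
      ⟨Module.End.mem_eigenspace_iff.2 (by simpa using hMv), hv⟩
    have := Module.End.aeval_apply_of_hasEigenvector (p := derivative M.charpoly) hev
    rw [hc', zero_smul] at this
    rw [← this, ← toLin'_apply]
    congr 1
    exact (Polynomial.aeval_algHom_apply (toLinAlgEquiv' (R := F) (n := ι)).toAlgHom M _).symm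
  · intro h
    obtain ⟨a, b, hab⟩ := h.separable
    have := congrArg (aeval M) hab
    rw [map_add, map_mul, map_mul, aeval_self_charpoly, mul_zero, zero_add, map_one] at this
    have := congrArg Matrix.det this
    rw [det_mul, det_one] at this
    exact right_ne_zero_of_mul_eq_one this

theorem HasDistinctEigenvalues.algebraMap_add_smul {M : Matrix ι ι F}
    (h : HasDistinctEigenvalues M) (a : F) {b : F} (hb : b ≠ 0) :
    HasDistinctEigenvalues (algebraMap F _ a + b • M) := by
  obtain ⟨d, v, hd, hv⟩ := h
  refine ⟨fun i => a + b * d i, v, fun i j hij => hd (by simpa [hb] using hij), fun i =>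
    ⟨(hv i).1, ?_⟩⟩
  rw [add_mulVec, smul_mulVec, (hv i).2, Algebra.algebraMap_eq_smul_one, smul_mulVec,
    one_mulVec, add_smul, mul_smul]

end DistinctEigenvalues

/-! ### Trace-zero matrices as differences of triangular conjugates -/

section Difference

variable {F : Type*} [Field F] {n : ℕ}

theorem mem_image_sub_image_of_hasDistinctEigenvalues [CharZero F] {f : FreeAlgebra F ℕ}
    {M : Matrix (Fin n) (Fin n) F} (hM : M ∈ image f (Matrix (Fin n) (Fin n) F))
    (h : HasDistinctEigenvalues M) {T : Matrix (Fin n) (Fin n) F} (hT : T.trace = 0) :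
    T ∈ image f (Matrix (Fin n) (Fin n) F) - image f (Matrix (Fin n) (Fin n) F) := by
  obtain ⟨d, v, hd, hv⟩ := h
  have hD : diagonal d ∈ image f (Matrix (Fin n) (Fin n) F) :=
    (HasDistinctEigenvalues.similar_diagonal hd hv).symm.mem_image hM
  obtain ⟨S, hTS, hS⟩ := exists_similar_diag_eq_zero T hT
  -- Since `S` has zero diagonal, `U - S` is lower triangular with the same diagonal `d`.
  let U : Matrix (Fin n) (Fin n) F := of fun i j => if i < j then S i j else if i = j then d i else 0
  have hU : Similar (diagonal d) U := by
    apply similar_diagonal_of_charpoly_eq hd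
    rw [charpoly_of_isUpperTriangular]
    · simp [U]
    · intro i j hij
      have hij : j < i := hij
      simp [U, hij.not_gt, hij.ne']
  have hL : Similar (diagonal d) (U - S) := by
    apply similar_diagonal_of_charpoly_eq hd
    rw [← charpoly_transpose, charpoly_of_isUpperTriangular]
    · simp [U, hS]
    · intro i j hij
      have hij : j < i := hij
      simp [U, hij]
  obtain ⟨u, w, huw, hwu, hTu⟩ := hTS.symm
  refine ⟨u * U * w, (Similar.trans hU ⟨u, w, huw, hwu, rfl⟩).mem_image hD,
    u * (U - S) * w, (Similar.trans hL ⟨u, w, huw, hwu, rfl⟩).mem_image hD, ?_⟩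
  simp only [hTu]
  noncomm_ring

end Difference

/-! ### Commutation up to a root of unity -/

section WeylCommutation

variable {F : Type*} [Field F] [IsAlgClosed F] {n : ℕ} [NeZero n]

/-- An invertible matrix `W` with `V W = ω W V`, where `V` is invertible and `ω` is a primitive
root of unity of order the size of `W`, has distinct eigenvalues. -/
theorem hasDistinctEigenvalues_of_mul_eq_smul_mul {V W : Matrix (Fin n) (Fin n) F} {ω : F}
    (hω : IsPrimitiveRoot ω n) (hV : IsUnit V) (hW : IsUnit W) (h : V * W = ω • (W * V)) :
    HasDistinctEigenvalues W := by
  have hdeg : W.charpoly.degree ≠ 0 := by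
    rw [charpoly_degree_eq_dim]; simpa using NeZero.ne n
  obtain ⟨c, hc⟩ := IsAlgClosed.exists_root _ hdeg
  obtain ⟨v, hv, hWv⟩ := exists_eigenvector_of_isRoot_charpoly hc
  have hVinj : ∀ x, V *ᵥ x = 0 → x = 0 := fun x hx =>
    (mulVec_injective_iff_isUnit.2 hV) (by simpa using hx)
  have hWinj : ∀ x, W *ᵥ x = 0 → x = 0 := fun x hx =>
    (mulVec_injective_iff_isUnit.2 hW) (by simpa using hx)
  have hc0 : c ≠ 0 := by
    rintro rfl
    exact hv (hWinj v (by simpa using hWv))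
  have hω0 : ω ≠ 0 := hω.ne_zero (NeZero.ne n)
  -- `V` carries eigenvectors of `W` to eigenvectors, multiplying the eigenvalue by `ω⁻¹`.
  have key : ∀ k : ℕ, ∃ x, x ≠ 0 ∧ W *ᵥ x = ((ω⁻¹) ^ k * c) • x := by
    intro k
    induction k with
    | zero => exact ⟨v, hv, by simpa using hWv⟩
    | succ k ih =>
      obtain ⟨x, hx, hWx⟩ := ih
      refine ⟨V *ᵥ x, fun h0 => hx (hVinj x h0), ?_⟩
      have h' : W * V = ω⁻¹ • (V * W) := by rw [h, smul_smul, inv_mul_cancel₀ hω0, one_smul]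
      rw [mulVec_mulVec, h', smul_mulVec, ← mulVec_mulVec, hWx, mulVec_smul, smul_smul,
        pow_succ']
      congr 1; ring
  choose x hx using key
  refine ⟨fun i => (ω⁻¹) ^ (i : ℕ) * c, fun i => x i, fun i j hij => ?_, fun i => hx i⟩
  exact Fin.ext (hω.inv.pow_inj i.2 j.2 (mul_right_cancel₀ hc0 hij))

end WeylCommutation

/-! ### Clock and shift matrices -/

section ClockShift

variable {F : Type*} [Field F] {n : ℕ}

/-- The clock matrix `diag(1, ζ, …, ζ ^ (n - 1))`. -/
def clock (n : ℕ) (ζ : F) : Matrix (Fin n) (Fin n) F := diagonal fun i => ζ ^ (i : ℕ)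

theorem pow_val_add {ζ : F} (hζ : ζ ^ n = 1) (i j : Fin n) :
    ζ ^ ((i + j : Fin n) : ℕ) = ζ ^ (i : ℕ) * ζ ^ (j : ℕ) := by
  rw [Fin.val_add, ← pow_add]
  exact (pow_eq_pow_mod _ hζ).symm

theorem isUnit_clock {ζ : F} (hζ : ζ ≠ 0) : IsUnit (clock n ζ) := by
  rw [isUnit_iff_isUnit_det, clock, det_diagonal, isUnit_iff_ne_zero]
  exact Finset.prod_ne_zero_iff.2 fun i _ => pow_ne_zero _ hζ

theorem aeval_clock (ζ : F) (q : F[X]) :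
    aeval (clock n ζ) q = diagonal fun i : Fin n => q.eval (ζ ^ (i : ℕ)) := by
  have : clock n ζ = diagonalAlgHom F (fun i : Fin n => ζ ^ (i : ℕ)) := rfl
  rw [this, aeval_algHom_apply]
  change diagonal _ = _
  congr 1
  ext i
  exact (aeval_algHom_apply (Pi.evalAlgHom F (fun _ : Fin n => F) i) _ q).symm

variable [NeZero n]

theorem pow_val_one {ζ : F} (hζ : ζ ^ n = 1) : ζ ^ ((1 : Fin n) : ℕ) = ζ := by
  rw [Fin.val_one', ← pow_eq_pow_mod _ hζ, pow_one]

/-- The cyclic shift matrix, with ones at the positions `(i, i + 1)`. -/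
def shift (F : Type*) [Field F] (n : ℕ) [NeZero n] : Matrix (Fin n) (Fin n) F :=
  of fun i j => if j = i + 1 then 1 else 0

theorem isUnit_shift : IsUnit (shift F n) := by
  refine IsUnit.of_mul_eq_one (shift F n)ᵀ ?_
  ext i j
  simp [shift, Matrix.mul_apply, Matrix.one_apply, eq_comm]

theorem shift_mul_clock {ζ : F} (hζ : ζ ^ n = 1) :
    shift F n * clock n ζ = ζ • (clock n ζ * shift F n) := by
  ext i j
  by_cases h : j = i + 1
  · subst h
    simp only [shift, clock, mul_diagonal, Matrix.smul_apply, diagonal_mul, pow_val_add hζ,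
      pow_val_one hζ, of_apply, if_true, smul_eq_mul]
    ring
  · simp [shift, clock, mul_diagonal, diagonal_mul, h]

end ClockShift

/-! ### A noncentral value gives a nonzero off-diagonal entry -/

section NonCentral

variable {F : Type*} [Field F] {n : ℕ} [NeZero n]

/-- Otherwise permuting indices makes every value diagonal; conjugating a diagonal value by
transvections then forces it to be scalar. -/
theorem exists_mem_image_apply_zero_one_ne_zero (hn : (0 : Fin n) ≠ 1) {f : FreeAlgebra F ℕ}
    {M : Matrix (Fin n) (Fin n) F} (hM : M ∈ image f (Matrix (Fin n) (Fin n) F))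
    (hc : M ∉ Set.center (Matrix (Fin n) (Fin n) F)) :
    ∃ S ∈ image f (Matrix (Fin n) (Fin n) F), S 0 1 ≠ 0 := by
  by_contra! h
  have hoff : ∀ S ∈ image f (Matrix (Fin n) (Fin n) F), ∀ i j, i ≠ j → S i j = 0 := by
    rintro _ ⟨a, rfl⟩ i j hij
    let σ : Equiv.Perm (Fin n) := Equiv.swap (Equiv.swap 0 i 1) j * Equiv.swap 0 i
    have hσ0 : σ 0 = i := by
      have : i ≠ Equiv.swap 0 i 1 := by
        intro h'
        apply hn
        apply (Equiv.swap 0 i).injective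
        rw [Equiv.swap_apply_left, ← h']
      simp [σ, Equiv.swap_apply_of_ne_of_ne this hij]
    have hσ1 : σ 1 = j := by simp [σ]
    have := h _ ⟨_, (algHom_lift (reindexAlgEquiv F F σ.symm).toAlgHom a f).symm⟩
    simpa [hσ0, hσ1] using this
  have hdiag : ∀ i j, i ≠ j → M j j = M i i := by
    intro i j hij
    have h1 := hoff _ ((similar_transvection M hij 1).mem_image hM) i j hij
    simpa [hoff M hM i j hij, hoff M hM j i hij.symm, add_neg_eq_zero] using h1
  apply hc
  have : M = algebraMap F _ (M 0 0) := by
    ext i j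
    rw [algebraMap_matrix_apply]
    split_ifs with hij
    · subst hij
      by_cases h0 : i = 0
      · simp [h0]
      · exact hdiag _ _ (Ne.symm h0)
    · exact hoff M hM i j hij
  rw [this]
  exact Semigroup.mem_center_iff.2 fun g => (Algebra.commutes _ g).symm

end NonCentral

/-! ### The multilinear case -/

section Multilinear

variable {F : Type*} [Field F]

theorem exists_multilinearMap {m : ℕ} (x : Fin m → ℕ) (c : Equiv.Perm (Fin m) → F)
    (A : Type*) [Ring A] [Algebra F A] :
    ∃ g : MultilinearMap F (fun _ : Fin m => A) A, ∀ a : ℕ → A,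
      FreeAlgebra.lift F a
        (∑ σ : Equiv.Perm (Fin m), c σ • (List.ofFn fun i => FreeAlgebra.ι F (x (σ i))).prod) =
      g fun k => a (x k) := by
  refine ⟨∑ σ, c σ • (MultilinearMap.mkPiAlgebraFin F m A).domDomCongr σ, fun a => ?_⟩
  simp [map_sum, map_list_prod, List.map_ofFn, Function.comp_def]

variable {n : ℕ}

/-- Homogeneity for the grading of matrices by the residue of `j - i` modulo `n`. -/
def IsHomogeneousOfDegree (d : Fin n) (a : Matrix (Fin n) (Fin n) F) : Prop :=
  ∀ i j, j ≠ i + d → a i j = 0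

/-- The homogeneous component of degree `d`. -/
def component (d : Fin n) (a : Matrix (Fin n) (Fin n) F) : Matrix (Fin n) (Fin n) F :=
  of fun i j => if j = i + d then a i j else 0

theorem isHomogeneousOfDegree_component (d : Fin n) (a : Matrix (Fin n) (Fin n) F) :
    IsHomogeneousOfDegree d (component d a) := fun i j h => by simp [component, h]

theorem IsHomogeneousOfDegree.mul_clock {d : Fin n} {a : Matrix (Fin n) (Fin n) F}
    (h : IsHomogeneousOfDegree d a) {ζ : F} (hζ : ζ ^ n = 1) :
    a * clock n ζ = ζ ^ (d : ℕ) • (clock n ζ * a) := by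
  ext i j
  by_cases hj : j = i + d
  · subst hj
    simp only [clock, mul_diagonal, Matrix.smul_apply, diagonal_mul, pow_val_add hζ, smul_eq_mul]
    ring
  · simp [clock, mul_diagonal, diagonal_mul, h i j hj]

variable [NeZero n]

theorem sum_component (a : Matrix (Fin n) (Fin n) F) : ∑ d, component d a = a := by
  ext i j
  rw [Matrix.sum_apply, Finset.sum_eq_single (j - i)]
  · simp [component]
  · intro d _ hd
    simp only [component, of_apply, ite_eq_right_iff]
    rintro rfl
    simp at hd
  · simp

/-- Expanding every argument into homogeneous components, some term keeps the entry nonzero. The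
factor `ω` depends only on the degrees, so the relation survives the later change of `b`. -/
theorem IsMultilinear.exists_homogeneous {f : FreeAlgebra F ℕ} (hf : IsMultilinear f) {ζ : F}
    (hζ : ζ ^ n = 1) {a : ℕ → Matrix (Fin n) (Fin n) F} {i j : Fin n}
    (ha : FreeAlgebra.lift F a f i j ≠ 0) :
    ∃ (r : ℕ → Fin n) (b : ℕ → Matrix (Fin n) (Fin n) F) (ω : F),
      (∀ k, IsHomogeneousOfDegree (r k) (b k)) ∧ FreeAlgebra.lift F b f i j ≠ 0 ∧
      ∀ b' : ℕ → Matrix (Fin n) (Fin n) F, (∀ k, IsHomogeneousOfDegree (r k) (b' k)) →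
        FreeAlgebra.lift F b' f * clock n ζ = ω • (clock n ζ * FreeAlgebra.lift F b' f) := by
  obtain ⟨m, x, c, hx, rfl⟩ := hf
  obtain ⟨g, hg⟩ := exists_multilinearMap x c (Matrix (Fin n) (Fin n) F)
  have hsum : g (fun k => a (x k)) = ∑ r : Fin m → Fin n, g fun k => component (r k) (a (x k)) := by
    have := g.map_sum fun k d => component d (a (x k))
    simpa only [sum_component] using this
  rw [hg, hsum, Matrix.sum_apply] at ha
  obtain ⟨r, -, hr⟩ := Finset.exists_ne_zero_of_sum_ne_zero ha
  let r' : ℕ → Fin n := Function.extend x r 0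
  refine ⟨r', fun k => component (r' k) (a k), ∏ k, ζ ^ (r k : ℕ),
    fun k => isHomogeneousOfDegree_component _ _, ?_, fun b hb => ?_⟩
  · rw [hg]
    simpa only [r', hx.extend_apply] using hr
  · rw [← lift_semiconj _ (a := fun k => ζ ^ (r' k : ℕ) • b k) (b := b) (u := clock n ζ), hg, hg,
      g.map_smul_univ, mul_smul_comm]
    · simp only [r', hx.extend_apply]
    · intro k
      rw [(hb k).mul_clock hζ, mul_smul_comm]

/-- A family with nonzero `(0, 1)` entry of the value can be averaged over the cyclic shifts of
the indices so that all the entries `(i, i + 1)` of the value are nonzero. -/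
theorem exists_homogeneous_apply_add_one_ne_zero [Infinite F] {f : FreeAlgebra F ℕ}
    {r : ℕ → Fin n} {b : ℕ → Matrix (Fin n) (Fin n) F}
    (hb : ∀ k, IsHomogeneousOfDegree (r k) (b k)) (h : FreeAlgebra.lift F b f 0 1 ≠ 0) :
    ∃ b' : ℕ → Matrix (Fin n) (Fin n) F, (∀ k, IsHomogeneousOfDegree (r k) (b' k)) ∧
      ∀ i, FreeAlgebra.lift F b' f i (i + 1) ≠ 0 := by
  let χ (s : Fin n) : Matrix (Fin n) (Fin n) F ≃ₐ[F] Matrix (Fin n) (Fin n) F :=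
    reindexAlgEquiv F F (Equiv.addRight s).symm
  have hχ : ∀ s a i j, χ s a i j = a (i + s) (j + s) := fun s a i j => rfl
  let B (k : ℕ) : Matrix (Fin n) (Fin n) (MvPolynomial (Fin n) F) :=
    of fun i j => ∑ s, MvPolynomial.C (χ s (b k) i j) * MvPolynomial.X s
  let φ (t : Fin n → F) : Matrix (Fin n) (Fin n) (MvPolynomial (Fin n) F) →ₐ[F]
    Matrix (Fin n) (Fin n) F := (MvPolynomial.aeval t).mapMatrix
  have hφB : ∀ t k i j, φ t (B k) i j = ∑ s, χ s (b k) i j * t s := by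
    intro t k i j
    simp [φ, B, AlgHom.mapMatrix_apply]
  let p (i : Fin n) : MvPolynomial (Fin n) F := FreeAlgebra.lift F B f i (i + 1)
  have hp : ∀ t i, MvPolynomial.eval t (p i) =
      FreeAlgebra.lift F (fun k => φ t (B k)) f i (i + 1) := by
    intro t i
    rw [← algHom_lift]
    simp [φ, p, AlgHom.mapMatrix_apply, MvPolynomial.aeval_eq_eval]
  have hp0 : ∀ i, p i ≠ 0 := by
    -- At this point the generic combination is the single shift by `-i`, whose value has at `(i, i
    -- + 1)` the original entry `(0, 1)`.
    intro i h0
    have h1 := hp (Pi.single (-i) 1) i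
    have h2 : (fun k => φ (Pi.single (-i) 1) (B k)) = fun k => (χ (-i)).toAlgHom (b k) := by
      ext k u v
      rw [hφB]
      simp [Pi.single_apply]
    rw [h0, map_zero, h2, ← algHom_lift] at h1
    apply h
    rw [h1]
    change _ = χ (-i) _ _ _
    rw [hχ]
    simp
  have hprod : ∏ i, p i ≠ 0 := Finset.prod_ne_zero_iff.2 fun i _ => hp0 i
  obtain ⟨t, ht⟩ : ∃ t, MvPolynomial.eval t (∏ i, p i) ≠ 0 := by
    by_contra! hall
    exact hprod (MvPolynomial.funext fun t => by rw [hall t, map_zero])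
  rw [map_prod, Finset.prod_ne_zero_iff] at ht
  refine ⟨fun k => φ t (B k), fun k i j hij => ?_, fun i => ?_⟩
  · change φ t (B k) i j = 0
    rw [hφB]
    refine Finset.sum_eq_zero fun s _ => ?_
    rw [hχ, hb k, zero_mul]
    intro h'
    apply hij
    apply add_right_cancel (b := s)
    rw [h']; abel
  · rw [← hp]
    exact ht i (Finset.mem_univ i)

theorem IsMultilinear.exists_hasDistinctEigenvalues [IsAlgClosed F] [CharZero F]
    {f : FreeAlgebra F ℕ} (hf : IsMultilinear f) (hn : (0 : Fin n) ≠ 1)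
    {M : Matrix (Fin n) (Fin n) F} (hM : M ∈ image f (Matrix (Fin n) (Fin n) F))
    (hc : M ∉ Set.center (Matrix (Fin n) (Fin n) F)) :
    ∃ S ∈ image f (Matrix (Fin n) (Fin n) F), HasDistinctEigenvalues S := by
  obtain ⟨ζ, hζ⟩ := HasEnoughRootsOfUnity.exists_primitiveRoot F n
  have hζ0 : ζ ≠ 0 := hζ.ne_zero (NeZero.ne n)
  obtain ⟨_, ⟨a, rfl⟩, ha⟩ := exists_mem_image_apply_zero_one_ne_zero hn hM hc
  obtain ⟨r, b, ω, hb, hb0, hω⟩ := hf.exists_homogeneous hζ.pow_eq_one ha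
  -- The entry `(0, 1)` has degree 1, which determines the factor.
  have hωζ : ω = ζ := by
    have := congrFun (congrFun (hω b hb) 0) 1
    simp only [clock, mul_diagonal, Matrix.smul_apply, diagonal_mul, pow_val_one hζ.pow_eq_one,
      smul_eq_mul, Fin.val_zero, pow_zero, one_mul] at this
    exact mul_left_cancel₀ hb0 (by rw [this, mul_comm])
  subst hωζ
  obtain ⟨b', hb', hne⟩ := exists_homogeneous_apply_add_one_ne_zero hb hb0
  have hcomm := hω b' hb'
  refine ⟨_, ⟨b', rfl⟩, ?_⟩
  change HasDistinctEigenvalues (FreeAlgebra.lift F b' f)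
  set S := FreeAlgebra.lift F b' f with hS
  have hzero : ∀ i j, j ≠ i + 1 → S i j = 0 := by
    intro i j hij
    have := congrFun (congrFun hcomm i) j
    simp only [clock, mul_diagonal, Matrix.smul_apply, diagonal_mul, smul_eq_mul] at this
    by_contra h0
    apply hij
    apply Fin.ext
    apply hζ.pow_inj j.2 (i + 1).2
    rw [pow_val_add hζ.pow_eq_one, pow_val_one hζ.pow_eq_one]
    apply mul_left_cancel₀ h0
    rw [this]; ring
  have hSeq : S = diagonal (fun i => S i (i + 1)) * shift F n := by
    ext i j
    by_cases h : j = i + 1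
    · simp [diagonal_mul, shift, h]
    · simp [diagonal_mul, shift, h, hzero i j h]
  have hSu : IsUnit S := by
    rw [hSeq]
    refine IsUnit.mul ?_ isUnit_shift
    rw [isUnit_iff_isUnit_det, det_diagonal, isUnit_iff_ne_zero]
    exact Finset.prod_ne_zero_iff.2 fun i _ => hne i
  refine hasDistinctEigenvalues_of_mul_eq_smul_mul hζ.inv (isUnit_clock hζ0) hSu ?_
  rw [hcomm, smul_smul, inv_mul_cancel₀ hζ0, one_smul]

end Multilinear

/-! ### The prime case -/

section Weyl

variable {F : Type*} [Field F] {n : ℕ} [NeZero n]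

/-- The products `P ^ i * Q ^ j` of powers of the clock matrix `P` and the shift matrix `Q`. -/
def weyl (ζ : F) (p : ℕ × ℕ) : Matrix (Fin n) (Fin n) F := clock n ζ ^ p.1 * shift F n ^ p.2

theorem shift_pow_mul_clock_pow {ζ : F} (hζ : ζ ^ n = 1) (j k : ℕ) :
    shift F n ^ j * clock n ζ ^ k = ζ ^ (j * k) • (clock n ζ ^ k * shift F n ^ j) := by
  have h1 : ∀ k, shift F n * clock n ζ ^ k = ζ ^ k • (clock n ζ ^ k * shift F n) := by
    intro k
    induction k with
    | zero => simp
    | succ k ih =>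
      rw [pow_succ, ← mul_assoc, ih, smul_mul_assoc, mul_assoc, shift_mul_clock hζ, mul_smul_comm,
        smul_smul, ← pow_succ, mul_assoc]
  induction j with
  | zero => simp
  | succ j ih =>
    rw [pow_succ', mul_assoc, ih, mul_smul_comm, ← mul_assoc, h1, smul_mul_assoc, smul_smul,
      ← pow_add, mul_assoc]
    congr 2; ring

theorem weyl_mul_weyl {ζ : F} (hζ : ζ ^ n = 1) (p q : ℕ × ℕ) :
    (weyl ζ p * weyl ζ q : Matrix (Fin n) (Fin n) F) = ζ ^ (p.2 * q.1) • weyl ζ (p + q) := by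
  rw [weyl, weyl, mul_assoc, ← mul_assoc (shift F n ^ p.2), shift_pow_mul_clock_pow hζ, weyl,
    Prod.fst_add, Prod.snd_add, pow_add, pow_add]
  simp only [mul_smul_comm, smul_mul_assoc, mul_assoc]

theorem shift_pow_apply (d : ℕ) (i j : Fin n) :
    (shift F n ^ d) i j = if j = i + Fin.ofNat n d then 1 else 0 := by
  induction d generalizing i j with
  | zero => simp [Matrix.one_apply, eq_comm]
  | succ d ih =>
    have : Fin.ofNat n (d + 1) = Fin.ofNat n d + 1 := by
      apply Fin.ext
      simp [Fin.val_add]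
    rw [pow_succ, Matrix.mul_apply]
    simp only [ih, this]
    simp only [shift, of_apply, ite_mul, one_mul, zero_mul, Finset.sum_ite_eq',
      Finset.mem_univ, if_true, add_assoc]

/-- A component of degree `d` is a diagonal matrix times `Q ^ d`, and Lagrange interpolation at the
distinct `ζ ^ i` writes any diagonal matrix as a polynomial in `P`. -/
theorem span_range_weyl {ζ : F} (hζ : IsPrimitiveRoot ζ n) :
    Submodule.span F (Set.range (weyl (n := n) ζ)) = ⊤ := by
  rw [eq_top_iff]
  rintro a -
  rw [← sum_component a]
  refine Submodule.sum_mem _ fun d _ => ?_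
  have hinj : Set.InjOn (fun i : Fin n => ζ ^ (i : ℕ)) (Finset.univ : Finset (Fin n)) :=
    fun i _ j _ hij => Fin.ext (hζ.pow_inj i.2 j.2 hij)
  let q := Lagrange.interpolate Finset.univ (fun i : Fin n => ζ ^ (i : ℕ)) fun i => a i (i + d)
  have hq : ∀ i : Fin n, q.eval (ζ ^ (i : ℕ)) = a i (i + d) := fun i =>
    Lagrange.eval_interpolate_at_node _ hinj (Finset.mem_univ i)
  have hcomp : component d a = aeval (clock n ζ) q * shift F n ^ (d : ℕ) := by
    ext i j
    rw [aeval_clock, diagonal_mul, shift_pow_apply, hq]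
    by_cases h : j = i + d <;> simp [component, h]
  rw [hcomp, aeval_eq_sum_range, Finset.sum_mul]
  refine Submodule.sum_mem _ fun k _ => ?_
  rw [smul_mul_assoc]
  exact Submodule.smul_mem _ _ (Submodule.subset_span ⟨(k, d), rfl⟩)

theorem isUnit_weyl {ζ : F} (hζ : ζ ≠ 0) (p : ℕ × ℕ) :
    IsUnit (weyl ζ p : Matrix (Fin n) (Fin n) F) :=
  ((isUnit_clock hζ).pow _).mul (isUnit_shift.pow _)

theorem clock_mul_weyl {ζ : F} (hζ : ζ ^ n = 1) (hζ0 : ζ ≠ 0) (p : ℕ × ℕ) :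
    clock n ζ * weyl ζ p = (ζ⁻¹) ^ p.2 • (weyl ζ p * clock n ζ) := by
  have h := weyl_mul_weyl (n := n) hζ p (1, 0)
  have h' := weyl_mul_weyl (n := n) hζ (1, 0) p
  have h1 : (weyl ζ (1, 0) : Matrix (Fin n) (Fin n) F) = clock n ζ := by simp [weyl]
  rw [h1] at h h'
  rw [h', h, smul_smul, add_comm (1, 0) p]
  simp [hζ0]

theorem shift_mul_weyl {ζ : F} (hζ : ζ ^ n = 1) (p : ℕ × ℕ) :
    shift F n * weyl ζ p = ζ ^ p.1 • (weyl ζ p * shift F n) := by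
  have h := weyl_mul_weyl (n := n) hζ p (0, 1)
  have h' := weyl_mul_weyl (n := n) hζ (0, 1) p
  have h1 : (weyl ζ (0, 1) : Matrix (Fin n) (Fin n) F) = shift F n := by simp [weyl]
  rw [h1] at h h'
  rw [h', h, smul_smul, add_comm (0, 1) p]
  simp

theorem weyl_mem_center {ζ : F} (hζ : IsPrimitiveRoot ζ n) {p : ℕ × ℕ}
    (h1 : Commute (clock n ζ) (weyl ζ p)) (h2 : Commute (shift F n) (weyl ζ p)) :
    (weyl ζ p : Matrix (Fin n) (Fin n) F) ∈ Set.center (Matrix (Fin n) (Fin n) F) := by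
  rw [Semigroup.mem_center_iff]
  intro a
  have ha : a ∈ Submodule.span F (Set.range (weyl (n := n) ζ)) := by
    rw [span_range_weyl hζ]; trivial
  change Commute a _
  induction ha using Submodule.span_induction with
  | mem x hx =>
    obtain ⟨q, rfl⟩ := hx
    exact (h1.pow_left _).mul_left (h2.pow_left _)
  | zero => exact Commute.zero_left _
  | add x y _ _ hx hy => exact hx.add_left hy
  | smul c x _ hx => exact hx.smul_left c

/-- Commuting with `P` and `Q` costs `n`-th roots of unity. If both are 1 the product is central;
otherwise one is primitive, as `n` is prime. -/
theorem hasDistinctEigenvalues_weyl [IsAlgClosed F] (hn : n.Prime) {ζ : F}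
    (hζ : IsPrimitiveRoot ζ n) {p : ℕ × ℕ}
    (hp : (weyl ζ p : Matrix (Fin n) (Fin n) F) ∉ Set.center (Matrix (Fin n) (Fin n) F)) :
    HasDistinctEigenvalues (weyl ζ p : Matrix (Fin n) (Fin n) F) := by
  have hζ0 : ζ ≠ 0 := hζ.ne_zero (NeZero.ne n)
  have : Fact n.Prime := ⟨hn⟩
  have hprim : ∀ ω : F, ω ^ n = 1 → ω ≠ 1 → IsPrimitiveRoot ω n := fun ω h h1 => by
    have := IsPrimitiveRoot.orderOf ω
    rwa [orderOf_eq_prime h h1] at this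
  have hP := clock_mul_weyl (n := n) hζ.pow_eq_one hζ0 p
  have hQ := shift_mul_weyl (n := n) hζ.pow_eq_one p
  by_cases h1 : (ζ⁻¹) ^ p.2 = 1
  · by_cases h2 : ζ ^ p.1 = 1
    · rw [h1, one_smul] at hP
      rw [h2, one_smul] at hQ
      exact absurd (weyl_mem_center hζ hP hQ) hp
    · refine hasDistinctEigenvalues_of_mul_eq_smul_mul (hprim _ ?_ h2) isUnit_shift
        (isUnit_weyl hζ0 p) hQ
      rw [← pow_mul, mul_comm, pow_mul, hζ.pow_eq_one, one_pow]
  · refine hasDistinctEigenvalues_of_mul_eq_smul_mul (hprim _ ?_ h1) (isUnit_clock hζ0)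
      (isUnit_weyl hζ0 p) hP
    rw [← pow_mul, mul_comm, pow_mul, hζ.inv.pow_eq_one, one_pow]

/-- The functions `(s, t) ↦ s ^ i * t ^ j • P ^ i * Q ^ j`. -/
def weylMonomial (ζ : F) (p : ℕ × ℕ) : F × F → Matrix (Fin n) (Fin n) F :=
  fun z => (z.1 ^ p.1 * z.2 ^ p.2) • weyl ζ p

/-- The algebra spanned by the functions `(s, t) ↦ s ^ i * t ^ j • P ^ i * Q ^ j`. -/
def weylAlgebra {ζ : F} (hζ : ζ ^ n = 1) : Subalgebra F (F × F → Matrix (Fin n) (Fin n) F) :=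
  (Submodule.span F (Set.range (weylMonomial (n := n) ζ))).toSubalgebra
    (Submodule.subset_span ⟨0, by ext z : 1; simp [weylMonomial, weyl]⟩)
    (by
      intro x y hx hy
      have hxy := Submodule.mul_mem_mul hx hy
      rw [Submodule.span_mul_span] at hxy
      refine Submodule.span_le.2 ?_ hxy
      rintro _ ⟨_, ⟨p, rfl⟩, _, ⟨q, rfl⟩, rfl⟩
      have : weylMonomial (n := n) ζ p * weylMonomial ζ q =
          ζ ^ (p.2 * q.1) • weylMonomial ζ (p + q) := by
        ext z : 1
        simp only [weylMonomial, Pi.mul_apply, Pi.smul_apply, smul_mul_smul_comm,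
          weyl_mul_weyl hζ, smul_smul]
        congr 1
        simp only [Prod.fst_add, Prod.snd_add]
        ring
      change weylMonomial (n := n) ζ p * weylMonomial ζ q ∈ _
      rw [this]
      exact Submodule.smul_mem _ _ (Submodule.subset_span ⟨_, rfl⟩))

theorem exists_mem_weylAlgebra_apply_one {ζ : F} (hζ : IsPrimitiveRoot ζ n)
    (a : Matrix (Fin n) (Fin n) F) :
    ∃ y : weylAlgebra (n := n) hζ.pow_eq_one, (y : F × F → Matrix (Fin n) (Fin n) F) 1 = a := by
  have ha : a ∈ Submodule.span F (Set.range (weyl (n := n) ζ)) := by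
    rw [span_range_weyl hζ]; trivial
  rw [Finsupp.mem_span_range_iff_exists_finsupp] at ha
  obtain ⟨e, rfl⟩ := ha
  refine ⟨⟨e.sum fun p c => c • weylMonomial ζ p, ?_⟩, ?_⟩
  · exact Finsupp.mem_span_range_iff_exists_finsupp.2 ⟨e, rfl⟩
  · simp [Finsupp.sum, weylMonomial]

/-- A noncentral value of `f` deforms to a two-parameter family of values. -/
theorem exists_weyl_family {ζ : F} (hζ : IsPrimitiveRoot ζ n) {f : FreeAlgebra F ℕ}
    {M : Matrix (Fin n) (Fin n) F} (hM : M ∈ image f (Matrix (Fin n) (Fin n) F)) :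
    ∃ e : ℕ × ℕ →₀ F, M = ∑ p ∈ e.support, e p • weyl ζ p ∧ ∀ s t : F,
      ∑ p ∈ e.support, (e p * (s ^ p.1 * t ^ p.2)) • weyl ζ p ∈
        image f (Matrix (Fin n) (Fin n) F) := by
  obtain ⟨a, rfl⟩ := hM
  -- Lifted to the algebra of functions of `(s, t)`, the arguments give a value that is again a
  -- combination of monomials; each evaluation is a homomorphism, hence lands in the image.
  choose y hy using fun k => exists_mem_weylAlgebra_apply_one hζ (a k)
  have hmem : ((FreeAlgebra.lift F y f : weylAlgebra (n := n) hζ.pow_eq_one) :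
      F × F → Matrix (Fin n) (Fin n) F) ∈ Submodule.span F (Set.range (weylMonomial (n := n) ζ)) :=
    (FreeAlgebra.lift F y f).2
  obtain ⟨e, he⟩ := Finsupp.mem_span_range_iff_exists_finsupp.1 hmem
  have heval : ∀ z : F × F,
      FreeAlgebra.lift F (fun k => (y k : F × F → Matrix (Fin n) (Fin n) F) z) f =
        ∑ p ∈ e.support, (e p * (z.1 ^ p.1 * z.2 ^ p.2)) • weyl ζ p := by
    intro z
    have h := algHom_lift ((Pi.evalAlgHom F (fun _ => Matrix (Fin n) (Fin n) F) z).comp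
      (weylAlgebra (n := n) hζ.pow_eq_one).val) y f
    have h2 := congrFun he z
    simp only [Finsupp.sum, Finset.sum_apply, Pi.smul_apply, weylMonomial, smul_smul] at h2
    rw [h2]
    exact h.symm
  refine ⟨e, ?_, fun s t => ⟨_, heval (s, t)⟩⟩
  have := heval 1
  simp only [hy, Prod.fst_one, Prod.snd_one, one_pow, mul_one] at this
  exact this

theorem exists_hasDistinctEigenvalues_of_prime [IsAlgClosed F] [CharZero F] (hn : n.Prime)
    {f : FreeAlgebra F ℕ} {M : Matrix (Fin n) (Fin n) F}
    (hM : M ∈ image f (Matrix (Fin n) (Fin n) F))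
    (hc : M ∉ Set.center (Matrix (Fin n) (Fin n) F)) :
    ∃ S ∈ image f (Matrix (Fin n) (Fin n) F), HasDistinctEigenvalues S := by
  classical
  obtain ⟨ζ, hζ⟩ := HasEnoughRootsOfUnity.exists_primitiveRoot F n
  obtain ⟨e, he, hfam⟩ := exists_weyl_family hζ hM
  let Z := Subalgebra.center F (Matrix (Fin n) (Fin n) F)
  let s := e.support.filter fun p => (weyl ζ p : Matrix (Fin n) (Fin n) F) ∉ Z
  have hs : s.Nonempty := by
    by_contra hs
    apply hc
    rw [he]
    refine Subalgebra.sum_mem Z fun p hp => Subalgebra.smul_mem Z ?_ _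
    by_contra hpZ
    exact hs ⟨p, Finset.mem_filter.2 ⟨hp, hpZ⟩⟩
  -- On the curve `(z ^ N, z)` the term `p` has exponent `w p`; `N` exceeds all second exponents, so
  -- the weights are distinct.
  let N := s.sup Prod.snd + 1
  let w (p : ℕ × ℕ) : ℕ := N * p.1 + p.2
  have hw : ∀ p ∈ s, ∀ q ∈ s, w p = w q → p = q := by
    intro p hp q hq hpq
    have hlt : ∀ p ∈ s, p.2 < N := fun p hp => Nat.lt_succ_of_le (Finset.le_sup (f := Prod.snd) hp)
    have h2 : p.2 = q.2 := by
      have := congrArg (· % N) hpq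
      simpa [w, Nat.mul_add_mod, Nat.mod_eq_of_lt (hlt p hp), Nat.mod_eq_of_lt (hlt q hq)] using this
    refine Prod.ext ?_ h2
    have : N * p.1 = N * q.1 := by simp only [w, h2] at hpq; omega
    exact Nat.eq_of_mul_eq_mul_left (Nat.succ_pos _) this
  obtain ⟨p₀, hp₀, hmin⟩ := s.exists_min_image w hs
  -- The noncentral part divided by its lowest power of `z`; only `p₀` survives at 0.
  let E : Matrix (Fin n) (Fin n) F[X] :=
    ∑ p ∈ s, (C (e p) * X ^ (w p - w p₀)) • (weyl ζ p : Matrix (Fin n) (Fin n) F).map C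
  have hE : ∀ z, E.map (evalRingHom z) = ∑ p ∈ s, (e p * z ^ (w p - w p₀)) • weyl ζ p := by
    intro z
    ext i j
    simp [E, Matrix.sum_apply, eval_finsetSum, mul_right_comm]
  have hE0 : HasDistinctEigenvalues (E.map (evalRingHom 0)) := by
    rw [hE, Finset.sum_eq_single p₀]
    · have hp := Finset.mem_filter.1 hp₀
      have := (hasDistinctEigenvalues_weyl hn hζ hp.2).algebraMap_add_smul 0
        (b := e p₀) (Finsupp.mem_support_iff.1 hp.1)
      simpa using this
    · intro p hp hne
      have : w p - w p₀ ≠ 0 := by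
        have h1 := hmin p hp
        have h2 : w p ≠ w p₀ := fun h => hne (hw p hp p₀ hp₀ h)
        omega
      rw [zero_pow this, mul_zero, zero_smul]
    · exact fun h => absurd hp₀ h
  -- The factor `X` forces `z ≠ 0`, so that the power of `z` can be restored.
  have hdisc : X * charDisc E ≠ 0 := by
    refine mul_ne_zero X_ne_zero fun h => charDisc_ne_zero_iff.2 hE0 ?_
    rw [charDisc_map, h, map_zero]
  obtain ⟨z, hz⟩ : ∃ z, (X * charDisc E).eval z ≠ 0 := by
    by_contra! hall
    exact hdisc (Polynomial.funext fun z => by rw [hall z, eval_zero])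
  rw [eval_mul, eval_X] at hz
  have hEz : HasDistinctEigenvalues (E.map (evalRingHom z)) := by
    rw [← charDisc_ne_zero_iff, charDisc_map]
    exact right_ne_zero_of_mul hz
  refine ⟨_, hfam (z ^ N) z, ?_⟩
  -- The central terms add up to a scalar, which only translates the eigenvalues.
  have hcentral : ∑ p ∈ e.support with (weyl ζ p : Matrix (Fin n) (Fin n) F) ∈ Z,
      (e p * ((z ^ N) ^ p.1 * z ^ p.2)) • (weyl ζ p : Matrix (Fin n) (Fin n) F) ∈ Z :=
    Subalgebra.sum_mem Z fun p hp => Subalgebra.smul_mem Z (Finset.mem_filter.1 hp).2 _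
  obtain ⟨c, hcc⟩ := Algebra.mem_bot.1 ((Algebra.IsCentral.center_eq_bot F _).le hcentral)
  have hrest : ∑ p ∈ s, (e p * ((z ^ N) ^ p.1 * z ^ p.2)) • (weyl ζ p : Matrix (Fin n) (Fin n) F) =
      z ^ w p₀ • E.map (evalRingHom z) := by
    rw [hE, Finset.smul_sum]
    refine Finset.sum_congr rfl fun p hp => ?_
    rw [smul_smul]
    congr 1
    have : (z ^ N) ^ p.1 * z ^ p.2 = z ^ w p₀ * z ^ (w p - w p₀) := by
      rw [← pow_mul, ← pow_add, ← pow_add, Nat.add_sub_cancel' (hmin p hp)]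
    rw [this]; ring
  rw [← Finset.sum_filter_add_sum_filter_not e.support
    (fun p => (weyl ζ p : Matrix (Fin n) (Fin n) F) ∈ Z), ← hcc]
  change HasDistinctEigenvalues (_ + ∑ p ∈ s, _)
  rw [hrest]
  exact hEz.algebraMap_add_smul c (pow_ne_zero _ (left_ne_zero_of_mul hz))

end Weyl

end NCPoly

theorem mainTheorem5 {F : Type*} [Field F] [IsAlgClosed F] [CharZero F] (n : ℕ)
    (f : FreeAlgebra F ℕ)
    (hid : ¬ NCPoly.IsIdentity f (Matrix (Fin n) (Fin n) F))
    (hcentral : ¬ NCPoly.IsCentral f (Matrix (Fin n) (Fin n) F))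
    (h : n.Prime ∨ NCPoly.IsMultilinear f) :
    {T : Matrix (Fin n) (Fin n) F | T.trace = 0} ⊆
      NCPoly.image f (Matrix (Fin n) (Fin n) F) - NCPoly.image f (Matrix (Fin n) (Fin n) F) := by
  obtain ⟨M, hM, hc⟩ : ∃ M ∈ NCPoly.image f (Matrix (Fin n) (Fin n) F),
      M ∉ Set.center (Matrix (Fin n) (Fin n) F) :=
    Set.not_subset.1 fun hsub => hcentral ⟨hsub, hid⟩
  have hn : 2 ≤ n := by
    by_contra! hn
    have : Subsingleton (Fin n) := Fin.subsingleton_iff_le_one.2 (by omega)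
    refine hc (Semigroup.mem_center_iff.2 fun a => ?_)
    ext i j
    obtain rfl := Subsingleton.elim i j
    simp [Matrix.mul_apply, Fintype.sum_subsingleton _ i, mul_comm]
  have : NeZero n := ⟨by omega⟩
  have h01 : (0 : Fin n) ≠ 1 := by
    intro h01
    have := congrArg Fin.val h01
    rw [Fin.val_zero, Fin.val_one', Nat.mod_eq_of_lt (by omega)] at this
    omega
  obtain ⟨S, hS, hSd⟩ : ∃ S ∈ NCPoly.image f (Matrix (Fin n) (Fin n) F),
      NCPoly.HasDistinctEigenvalues S := by
    rcases h with hp | hf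
    · exact NCPoly.exists_hasDistinctEigenvalues_of_prime hp hM hc
    · exact hf.exists_hasDistinctEigenvalues h01 hM hc
  exact fun T hT => NCPoly.mem_image_sub_image_of_hasDistinctEigenvalues hS hSd hT
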